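/- **Conventions.** A (multisorted) signature consists of finitely many types and finitely many relational symbols $R$, each with an arity $\mathrm{ar}_R$, a finite tuple of types. A structure $\mathbf A$ has a set $A_t$ for each type $t$ (elements of different types are considered different) and a relation $R^{\mathbf A}\subseteq \prod_i A_{\mathrm{ar}_R(i)}$ for each symbol $R$. Homomorphisms preserve types and relations; $\mathbf X\to\mathbf Y$ means that one exists. A promise template is a pair $(\mathbf A,\mathbf A')$ of structures of the same signature with $\mathbf A\to\mathbf A'$ and $\mathbf A$ finite ($\mathbf A'$ may be infinite). Instances of $\mathrm{PCSP}(\mathbf A,\mathbf A')$ are finite structures $\mathbf X$ of that signature. A reduction from $\mathrm{PCSP}(\mathbf A,\mathbf A')$ to $\mathrm{PCSP}(\mathbf B,\mathbf B')$ is a map $\psi$ from instances to instances such that $\mathbf X\to\mathbf A$ implies $\psi(\mathbf X)\to\mathbf B$, and $\mathbf X\not\to\mathbf A'$ implies $\psi(\mathbf X)\not\to\mathbf B'$. The power $\mathbf B^I$ has domains $B_t^I$ and coordinatewise relations. **Datalog.** A Datalog program with input signature $\Pi$ is given by finitely many new symbols (IDBs) over the types of $\Pi$, a finite set of rules $t_0\leftarrow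 t_1,\dots,t_r$, and an IDB designated as output. Here $t_0$ is an atom whose symbol is an IDB, and each of $t_1,\dots,t_r$ is an atom whose symbol is in $\Pi$ or is an IDB, or an equality of two variables of the same type. It has width at most $k$ if each rule has at most $k$ variables. On a $\Pi$-structure it outputs the output relation of the least fixed point of its rules. A Datalog interpretation $\phi$ from $\Pi$-structures to $\Sigma$-structures consists of a Datalog program $\phi_t$ for each $\Sigma$-type $t$ and a program $\phi_R$ for each $\Sigma$-symbol $R$, the arity of $\phi_R$ being the concatenation of the arities of $\phi_{\mathrm{ar}_R(1)},\dots,\phi_{\mathrm{ar}_R(m)}$. The structure $\phi(\mathbf X)$ has the domains $\phi_t(\mathbf X)$, and its relation $R$ consists of those tuples of $\prod_i\phi_{\mathrm{ar}_R(i)}(\mathbf X)$ whose concatenation is in $\phi_R(\mathbf X)$. Its width is at most $k$ if that of all the programs is. **Gadgets.** A gadget $\gamma$ from $\Pi$-structures to $\Sigma$-structures consists of finite $\Sigma$-structures $\mathbf D_t$ ($t$ a $\Pi$-type) and $\mathbf E_R$ ($R$ a $\Pi$-symbol), and homomorphisms $p_{R,i}\colon\mathbf D_{\mathrm{ar}_R(i)}\to\mathbf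 E_R$. The structure $\gamma(\mathbf X)$ is obtained from the disjoint union of a copy of $\mathbf D_t$ for each $x\in X_t$ and a copy of $\mathbf E_R$ for each $x\in R^{\mathbf X}$ by identifying $(x;p_{R,i}(e))$ with $(x_i;e)$ for all $R$, $x\in R^{\mathbf X}$, $i$, and $e\in\mathbf D_{\mathrm{ar}_R(i)}$. **The $k$-consistency reduction.** Given $\mathbf X$, for each set $K$ of at most $k$ elements of $\mathbf X$ start with the set $\mathcal F_K$ of all partial homomorphisms $K\to\mathbf A$. For $L\subset K$, remove from $\mathcal F_L$ the maps that do not extend to a map in $\mathcal F_K$, and from $\mathcal F_K$ the maps whose restriction to $L$ is not in $\mathcal F_L$; repeat while anything changes. Then $\kappa_k^{\mathbf A,\mathbf B}(\mathbf X)$ is obtained from the disjoint union of the powers $\mathbf B^{\mathcal F_K}$, with elements $(K;b)$, by identifying $(K;b\circ\rho)$ with $(L;b)$ for all $L\subseteq K$ and $b\in\mathbf B^{\mathcal F_L}$, where $\rho\colon\mathcal F_K\to\mathcal F_L$ is the restriction $g\mapsto g|_L$. **Theorem.** Let $k\ge 1$, and let $(\mathbf A,\mathbf A')$ and $(\mathbf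 B,\mathbf B')$ be two promise templates (possibly of different signatures). The following are equivalent: 1. There exist a Datalog interpretation $\phi$ of width at most $k$ and a gadget $\gamma$ (through any intermediate signature) such that $\gamma\circ\phi$ is a reduction from $\mathrm{PCSP}(\mathbf A,\mathbf A')$ to $\mathrm{PCSP}(\mathbf B,\mathbf B')$. 2. $\kappa_k^{\mathbf A,\mathbf B}$ is a reduction from $\mathrm{PCSP}(\mathbf A,\mathbf A')$ to $\mathrm{PCSP}(\mathbf B,\mathbf B')$. -/

import Mathlib

universe u

namespace PCSP

/-! ### Multisorted relational structures -/

/-- A finite multisorted relational signature: finitely many types, finitely many relational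
symbols, and for each symbol its arity, a tuple of types. -/
structure Signature where
  /-- the types (sorts) -/
  Ty : Type u
  /-- the relational symbols -/
  Sym : Type u
  /-- the arity of a symbol -/
  ar : Sym → List Ty
  finite_ty : Finite Ty
  finite_sym : Finite Sym

/-- A (not necessarily finite) relational structure of signature `S`. The domains `A_t` are given
as the fibres of the map `ty` that sends an element to its type, so elements of different types are
different. A relation is a set of tuples (lists) of elements, of the types the arity prescribes. -/
structure Structure (S : Signature.{u}) where
  carrier : Type u
  ty : carrier → S.Ty
  rel : S.Sym → Set (List carrier)
  rel_typed : ∀ R w, w ∈ rel R → w.map ty = S.ar R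

namespace Structure

variable {S : Signature.{u}}

/-- The domain of type `t`. -/
def Dom (X : Structure S) (t : S.Ty) : Type u := {a : X.carrier // X.ty a = t}

/-- A structure is finite if it has finitely many elements. -/
def IsFinite (X : Structure S) : Prop := Finite X.carrier

/-- Homomorphisms: maps that preserve types and relations. -/
structure Hom (X Y : Structure S) where
  toFun : X.carrier → Y.carrier
  map_ty : ∀ a, Y.ty (toFun a) = X.ty a
  map_rel : ∀ R w, w ∈ X.rel R → w.map toFun ∈ Y.rel R

/-- `X → Y`: there is a homomorphism from `X` to `Y`. -/
def MapsTo (X Y : Structure S) : Prop := Nonempty (Hom X Y)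

theorem length_eq (X : Structure S) {R : S.Sym} {w : List X.carrier} (hw : w ∈ X.rel R) :
    w.length = (S.ar R).length := by
  rw [← X.rel_typed R w hw, List.length_map]

/-- The `i`-th entry of a tuple in a relation, as an element of the `i`-th domain. -/
def entry (X : Structure S) {R : S.Sym} (w : X.rel R) (i : Fin (S.ar R).length) :
    X.Dom ((S.ar R).get i) :=
  ⟨w.1.get (Fin.cast (X.length_eq w.2).symm i), by
    have h := X.rel_typed R w.1 w.2
    simp [← h]⟩

/-- The power `B^I`: its domain of type `t` consists of all maps from `I` to the domain of `B` of
type `t`, and the relations are defined coordinatewise. -/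
def power (B : Structure S) (I : Type u) : Structure S where
  carrier := (t : S.Ty) × {b : I → B.carrier // ∀ i, B.ty (b i) = t}
  ty b := b.1
  rel R := {w | w.map Sigma.fst = S.ar R ∧ ∀ i, w.map (fun b => b.2.1 i) ∈ B.rel R}
  rel_typed _ _ hw := hw.1

/-- Precomposition `b ↦ b ∘ ρ` from `B^J` to `B^I`, for a map `ρ : I → J`. -/
def powerComp (B : Structure S) {I J : Type u} (ρ : I → J) (b : (B.power J).carrier) :
    (B.power I).carrier :=
  ⟨b.1, b.2.1 ∘ ρ, fun i => b.2.2 (ρ i)⟩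

/-- The disjoint union of a family of structures. -/
def disjointUnion {I : Type u} (Z : I → Structure S) : Structure S where
  carrier := (i : I) × (Z i).carrier
  ty z := (Z z.1).ty z.2
  rel R := {w | ∃ i, ∃ v ∈ (Z i).rel R, w = v.map (fun z => ⟨i, z⟩)}
  rel_typed := by
    rintro R _ ⟨i, v, hv, rfl⟩
    rw [List.map_map]
    exact (Z i).rel_typed R v hv

/-- The structure obtained by identifying all pairs of elements related by `r`, i.e., by taking the
quotient by the equivalence relation that `r` generates; a tuple is in a relation of the quotient
if it has a representative in the original relation. -/
def collapse (Z : Structure S) (r : Z.carrier → Z.carrier → Prop)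
    (hr : ∀ a b, r a b → Z.ty a = Z.ty b) : Structure S where
  carrier := Quot r
  ty := Quot.lift Z.ty hr
  rel R := {w | ∃ v ∈ Z.rel R, w = v.map (Quot.mk r)}
  rel_typed := by
    rintro R _ ⟨v, hv, rfl⟩
    rw [List.map_map]
    exact Z.rel_typed R v hv

end Structure

/-! ### Reductions -/

/-- `ψ` is a reduction from `PCSP(A, A')` to `PCSP(B, B')`: it maps instances, which are finite
structures, to instances; positive instances to positive ones, negative instances to negative
ones. -/
def IsReduction {S T : Signature.{u}} (A A' : Structure S) (B B' : Structure T)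
    (ψ : Structure S → Structure T) : Prop :=
  ∀ X : Structure S, X.IsFinite →
    (ψ X).IsFinite ∧
    (X.MapsTo A → (ψ X).MapsTo B) ∧
    (¬ X.MapsTo A' → ¬ (ψ X).MapsTo B')

/-! ### Gadgets -/

/-- A gadget mapping `S`-structures to `T`-structures. -/
structure Gadget (S T : Signature.{u}) where
  /-- the structure that replaces an element of type `t` -/
  D : S.Ty → Structure T
  /-- the structure that replaces a tuple in the relation `R` -/
  E : S.Sym → Structure T
  p : ∀ (R : S.Sym) (i : Fin (S.ar R).length), Structure.Hom (D ((S.ar R).get i)) (E R)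
  finite_D : ∀ t, (D t).IsFinite
  finite_E : ∀ R, (E R).IsFinite

namespace Gadget

variable {S T : Signature.{u}}

/-- The index set of the copies introduced by a gadget replacement: the elements of `X` with their
types, and the constraints of `X`. -/
abbrev Index (X : Structure S) : Type u :=
  ((t : S.Ty) × X.Dom t) ⊕ ((R : S.Sym) × X.rel R)

/-- The copy introduced for an element or for a constraint. -/
def piece (γ : Gadget S T) (X : Structure S) : Index X → Structure T
  | .inl a => γ.D a.1
  | .inr c => γ.E c.1

/-- The disjoint union of all the copies. -/
abbrev pieces (γ : Gadget S T) (X : Structure S) : Structure T :=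
  Structure.disjointUnion (γ.piece X)

/-- The equality constraints `(w; p_{R,i}(e)) = (w_i; e)`. -/
inductive Glue (γ : Gadget S T) (X : Structure S) :
    (γ.pieces X).carrier → (γ.pieces X).carrier → Prop
  | intro (R : S.Sym) (w : X.rel R) (i : Fin (S.ar R).length)
      (e : (γ.D ((S.ar R).get i)).carrier) :
      Glue γ X ⟨.inr ⟨R, w⟩, (γ.p R i).toFun e⟩ ⟨.inl ⟨(S.ar R).get i, X.entry w i⟩, e⟩

/-- The gadget replacement induced by `γ`. -/
def replace (γ : Gadget S T) (X : Structure S) : Structure T :=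
  (γ.pieces X).collapse (Glue γ X) (by
    rintro _ _ ⟨R, w, i, e⟩
    exact (γ.p R i).map_ty e)

end Gadget

/-! ### Datalog -/

/-- The extension of a signature by new relational symbols (the IDBs) over the same types. -/
def Signature.extend (S : Signature.{u}) (Idb : Type u) [Finite Idb] (idbAr : Idb → List S.Ty) :
    Signature.{u} where
  Ty := S.Ty
  Sym := S.Sym ⊕ Idb
  ar := Sum.elim S.ar idbAr
  finite_ty := S.finite_ty
  finite_sym := by
    have := S.finite_sym
    infer_instance

/-- Atomic formulae of signature `S` in `n` typed variables. -/
inductive Atom (S : Signature.{u}) {n : ℕ} (varTy : Fin n → S.Ty) : Type u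
  /-- `R(x_1, …, x_m)` -/
  | rel (R : S.Sym) (args : List (Fin n)) (typed : args.map varTy = S.ar R)
  /-- `x = y` -/
  | eq (x y : Fin n) (typed : varTy x = varTy y)

/-- The variables that occur in an atomic formula. -/
def Atom.vars {S : Signature.{u}} {n : ℕ} {varTy : Fin n → S.Ty} : Atom S varTy → List (Fin n)
  | .rel _ args _ => args
  | .eq x y _ => [x, y]

/-- A Datalog rule with input signature `S` and IDBs `Idb`. The head is an atomic formula whose
symbol is an IDB. The variables of the rule are numbered; each of them occurs in it. -/
structure Rule (S : Signature.{u}) (Idb : Type u) [Finite Idb] (idbAr : Idb → List S.Ty) where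
  nvars : ℕ
  varTy : Fin nvars → S.Ty
  head : Idb
  headArgs : List (Fin nvars)
  head_typed : headArgs.map varTy = idbAr head
  body : List (Atom (S.extend Idb idbAr) varTy)
  occurs : ∀ x : Fin nvars, x ∈ headArgs ∨ ∃ a ∈ body, x ∈ a.vars

/-- A Datalog program with input signature `S`. The output predicate is one of the IDBs. -/
structure DatalogProgram (S : Signature.{u}) where
  Idb : Type u
  [finite_idb : Finite Idb]
  idbAr : Idb → List S.Ty
  rules : Set (Rule S Idb idbAr)
  finite_rules : rules.Finite
  out : Idb

namespace DatalogProgram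

variable {S : Signature.{u}}

attribute [instance] finite_idb

/-- The arity of a program is the arity of its output predicate. -/
def arity (φ : DatalogProgram S) : List S.Ty := φ.idbAr φ.out

/-- The number of variables in each rule is at most `k`. -/
def WidthAtMost (φ : DatalogProgram S) (k : ℕ) : Prop := ∀ r ∈ φ.rules, r.nvars ≤ k

/-- The least fixed-point semantics: `φ.Derives X P w` says that `w` gets included in the relation
of the IDB `P` when `φ` is run on `X`. A rule applies under a type-preserving assignment `h` of its
variables that makes all the EDB atoms, IDB atoms and equalities in the body true. -/
inductive Derives (φ : DatalogProgram S) (X : Structure S) : φ.Idb → List X.carrier → Prop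
  | rule (r : Rule S φ.Idb φ.idbAr) (hr : r ∈ φ.rules) (h : Fin r.nvars → X.carrier)
      (typed : ∀ x, X.ty (h x) = r.varTy x)
      (edb : ∀ R args ht, Atom.rel (Sum.inl R) args ht ∈ r.body → args.map h ∈ X.rel R)
      (idb : ∀ P args ht, Atom.rel (Sum.inr P) args ht ∈ r.body → Derives φ X P (args.map h))
      (eq : ∀ x y ht, Atom.eq x y ht ∈ r.body → h x = h y) :
      Derives φ X r.head (r.headArgs.map h)

/-- The relation `φ(X)` that the program outputs. -/
def output (φ : DatalogProgram S) (X : Structure S) : Set (List X.carrier) :=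
  {w | φ.Derives X φ.out w}

end DatalogProgram

/-- A Datalog interpretation mapping `S`-structures to `T`-structures. The arity of the program for
a symbol is the concatenation of the arities of the programs for the types in its arity. -/
structure DatalogInterpretation (S T : Signature.{u}) where
  tyProg : T.Ty → DatalogProgram S
  symProg : T.Sym → DatalogProgram S
  arity_eq : ∀ R, (symProg R).arity = (T.ar R).flatMap (fun t => (tyProg t).arity)

namespace DatalogInterpretation

variable {S T : Signature.{u}}

/-- All the programs have width at most `k`. -/
def WidthAtMost (φ : DatalogInterpretation S T) (k : ℕ) : Prop :=
  (∀ t, (φ.tyProg t).WidthAtMost k) ∧ (∀ R, (φ.symProg R).WidthAtMost k)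

/-- The application of a Datalog interpretation: the elements of type `t` are the tuples in the
output of the program for `t`, and a tuple of elements of the types given by the arity of `R` is in
the relation `R` if the concatenation of its entries is in the output of the program for `R`. -/
def apply (φ : DatalogInterpretation S T) (X : Structure S) : Structure T where
  carrier := (t : T.Ty) × (φ.tyProg t).output X
  ty a := a.1
  rel R := {w | w.map Sigma.fst = T.ar R ∧
    w.flatMap (fun a => (a.2 : List X.carrier)) ∈ (φ.symProg R).output X}
  rel_typed _ _ hw := hw.1

end DatalogInterpretation

/-! ### The `k`-consistency reduction -/

section Consistency

variable {S T : Signature.{u}}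

/-- The restriction of a map defined on `K` to a subset `L` of `K`. -/
def restrict {X A : Type u} {L K : Finset X} (hLK : L ⊆ K) (g : K → A) : L → A :=
  fun x => g ⟨x.1, hLK x.2⟩

/-- Partial homomorphisms from a set `K` of elements of `X` to `A`. -/
def IsPartialHom (X A : Structure S) (K : Finset X.carrier) (f : K → A.carrier) : Prop :=
  (∀ x, A.ty (f x) = X.ty x.1) ∧
  ∀ (R : S.Sym) (w : List K), w.map Subtype.val ∈ X.rel R → w.map f ∈ A.rel R

/-- The subsets of `X` with at most `k` elements. -/
abbrev SmallSet (X : Structure S) (k : ℕ) : Type u := {K : Finset X.carrier // K.card ≤ k}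

/-- `Removed k X A K f` says that `f : K → A` does not survive the enforcement of `k`-consistency:
either it is not a partial homomorphism, or it does not extend to a surviving map on some larger
set, or its restriction to some smaller set does not survive. -/
inductive Removed (k : ℕ) (X A : Structure S) :
    (K : SmallSet X k) → (K.1 → A.carrier) → Prop
  | not_hom (K : SmallSet X k) (f : K.1 → A.carrier) (hf : ¬ IsPartialHom X A K.1 f) :
      Removed k X A K f
  | not_extends (L K : SmallSet X k) (hLK : L.1 ⊆ K.1) (h : L.1 → A.carrier)
      (hh : ∀ g : K.1 → A.carrier, restrict hLK g = h → Removed k X A K g) :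
      Removed k X A L h
  | not_restricts (L K : SmallSet X k) (hLK : L.1 ⊆ K.1) (g : K.1 → A.carrier)
      (hg : Removed k X A L (restrict hLK g)) :
      Removed k X A K g

/-- The set `ℱ_K` that results from enforcing `k`-consistency. -/
def consistentMaps (k : ℕ) (X A : Structure S) (K : SmallSet X k) : Set (K.1 → A.carrier) :=
  {f | ¬ Removed k X A K f}

/-- The restriction map `ρ : ℱ_K → ℱ_L`. -/
def restrictMap (k : ℕ) (X A : Structure S) {L K : SmallSet X k} (hLK : L.1 ⊆ K.1)
    (g : consistentMaps k X A K) : consistentMaps k X A L :=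
  ⟨restrict hLK g.1, fun h => g.2 (Removed.not_restricts L K hLK g.1 h)⟩

/-- The disjoint union of the copies of the powers `B^{ℱ_K}`. -/
abbrev consistencyPieces (k : ℕ) (A : Structure S) (B : Structure T) (X : Structure S) :
    Structure T :=
  Structure.disjointUnion (fun K : SmallSet X k => B.power (consistentMaps k X A K))

/-- The identifications `(K; b ∘ ρ) = (L; b)`. -/
inductive ConsistencyGlue (k : ℕ) (A : Structure S) (B : Structure T) (X : Structure S) :
    (consistencyPieces k A B X).carrier → (consistencyPieces k A B X).carrier → Prop
  | intro (L K : SmallSet X k) (hLK : L.1 ⊆ K.1)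
      (b : (B.power (consistentMaps k X A L)).carrier) :
      ConsistencyGlue k A B X ⟨K, B.powerComp (restrictMap k X A hLK) b⟩ ⟨L, b⟩

/-- The `k`-consistency reduction `κ_k^{A,B}`. -/
def consistencyReduction (k : ℕ) (A : Structure S) (B : Structure T) (X : Structure S) :
    Structure T :=
  (consistencyPieces k A B X).collapse (ConsistencyGlue k A B X) (by
    rintro _ _ ⟨L, K, hLK, b⟩
    rfl)

end Consistency

end PCSP

/-! Both directions compare the two constructions by homomorphisms that exist for every `X`, so that
positive and negative instances transfer between them. That `κ_k` preserves positive instances is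
immediate: the restrictions of a homomorphism `X → A` survive every removal, and evaluating each
power at them gives a homomorphism to `B` (`consistencyReduction_mapsTo`).

From 1 to 2, a surviving map sends Datalog facts of width `k` derivable in `X` to facts derivable in
`A` (`map_consistent`), since it can be extended from the head of a rule instance to its at most `k`
elements. Hence each `f ∈ ℱ_K` sends the elements and tuples of `φ(X)` supported in `K` into `φ(A)`.
Once `γ(φ(A)) → B`, which is the reduction applied to the instance `A`, letting `f` vary sends the
gadget copies into `B^{ℱ_K}`, and these maps glue to `γ(φ(X)) → κ_k(X)` (`replace_apply_mapsTo`).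

From 2 to 1, a canonical `φ` and `γ` are built. An IDB carries a set `F` of tuples of `A`, and the
rules are all small ones valid in `A`. In `A` every derived tuple therefore lies in its `F`, which
gives `γ(φ(A)) → B` by evaluation. In `X` the program simulates the removals, deriving the IDB with
`F = ℱ_K` at an enumeration of `K` (`bounds_consistentMaps`). The gadget puts `B^F` at such a fact,
so `κ_k(X) → γ(φ(X))`. With the homomorphism of the first direction, the two are homomorphically
equivalent. -/

namespace PCSP

/-! ### Homomorphisms, powers and collapsed disjoint unions -/

namespace Structure

variable {S : Signature.{u}}

theorem map_map_mem {α β δ : Type*} {f : α → β} {g : β → δ} {l : List α} {s : Set (List δ)}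
    (h : l.map (g ∘ f) ∈ s) : (l.map f).map g ∈ s := by
  rwa [List.map_map]

/-- The identity homomorphism. -/
def Hom.id (X : Structure S) : Hom X X where
  toFun := fun a => a
  map_ty _ := rfl
  map_rel R w hw := by simpa using hw

/-- Composition of homomorphisms. -/
def Hom.comp {X Y Z : Structure S} (g : Hom Y Z) (f : Hom X Y) : Hom X Z where
  toFun := g.toFun ∘ f.toFun
  map_ty a := (g.map_ty _).trans (f.map_ty a)
  map_rel R w hw := by
    rw [← List.map_map]
    exact g.map_rel R _ (f.map_rel R w hw)

theorem MapsTo.trans {X Y Z : Structure S} (h : X.MapsTo Y) (h' : Y.MapsTo Z) : X.MapsTo Z :=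
  h.elim fun f => h'.elim fun g => ⟨g.comp f⟩

/-- The universal property of the power: a family of homomorphisms to `B` is a homomorphism to a
power of `B`. -/
def Hom.toPower {Z B : Structure S} {I : Type u} (f : I → Hom Z B) : Hom Z (B.power I) where
  toFun z := ⟨Z.ty z, fun i => (f i).toFun z, fun i => (f i).map_ty z⟩
  map_ty _ := rfl
  map_rel R w hw := by
    refine ⟨?_, fun i => ?_⟩
    · exact List.map_map.trans (Z.rel_typed R w hw)
    · exact map_map_mem ((f i).map_rel R w hw)

theorem power_ext {B : Structure S} {I : Type u} {b c : (B.power I).carrier} (h : b.1 = c.1)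
    (h' : ∀ i, b.2.1 i = c.2.1 i) : b = c := by
  obtain ⟨t, b, hb⟩ := b
  obtain ⟨t', c, hc⟩ := c
  obtain rfl : t = t' := h
  obtain rfl : b = c := funext h'
  rfl

/-- The projection of a power to a coordinate. -/
def powerEval (B : Structure S) {I : Type u} (i : I) : Hom (B.power I) B where
  toFun b := b.2.1 i
  map_ty b := b.2.2 i
  map_rel _ _ hw := hw.2 i

/-- Precomposition with `ρ` as a homomorphism of powers. -/
def powerCompHom (B : Structure S) {I J : Type u} (ρ : I → J) : Hom (B.power J) (B.power I) where
  toFun := B.powerComp ρ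
  map_ty _ := rfl
  map_rel R w hw := by
    refine ⟨?_, fun i => ?_⟩
    · exact List.map_map.trans hw.1
    · exact map_map_mem (hw.2 (ρ i))

theorem power_isFinite {B : Structure S} (hB : B.IsFinite) (I : Type u) [Finite I] :
    (B.power I).IsFinite := by
  have : Finite B.carrier := hB
  have := S.finite_ty
  unfold IsFinite power
  infer_instance

theorem finite_lists_map_eq {α β : Type*} [Finite α] (f : α → β) (l : List β) :
    {w : List α | w.map f = l}.Finite := by
  refine Set.Finite.subset (List.finite_length_eq α l.length) ?_
  rintro w rfl
  simp

theorem finite_rel {X : Structure S} (hX : X.IsFinite) (R : S.Sym) : Finite (X.rel R) := by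
  have : Finite X.carrier := hX
  exact (finite_lists_map_eq X.ty (S.ar R)).subset (X.rel_typed R)

/-- A family of homomorphisms to `Y` that respects the identifications induces a homomorphism from
the collapsed disjoint union. -/
def Hom.glue {I : Type u} {Z : I → Structure S} {Y : Structure S}
    {r : (disjointUnion Z).carrier → (disjointUnion Z).carrier → Prop}
    (hr : ∀ a b, r a b → (disjointUnion Z).ty a = (disjointUnion Z).ty b)
    (f : ∀ i, Hom (Z i) Y)
    (hf : ∀ a b, r a b → (f a.1).toFun a.2 = (f b.1).toFun b.2) :
    Hom ((disjointUnion Z).collapse r hr) Y where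
  toFun := Quot.lift (fun a => (f a.1).toFun a.2) hf
  map_ty := by
    rintro ⟨a⟩
    exact (f a.1).map_ty a.2
  map_rel := by
    rintro R _ ⟨_, ⟨i, v, hv, rfl⟩, rfl⟩
    exact map_map_mem (map_map_mem ((f i).map_rel R v hv))

/-- The inclusion of a piece into the collapsed disjoint union. -/
def Hom.incl {I : Type u} {Z : I → Structure S}
    {r : (disjointUnion Z).carrier → (disjointUnion Z).carrier → Prop}
    (hr : ∀ a b, r a b → (disjointUnion Z).ty a = (disjointUnion Z).ty b) (i : I) :
    Hom (Z i) ((disjointUnion Z).collapse r hr) where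
  toFun z := Quot.mk r ⟨i, z⟩
  map_ty _ := rfl
  map_rel _ v hv := ⟨_, ⟨i, v, hv, rfl⟩, List.map_map.symm⟩

end Structure

open Structure

variable {S T U : Signature.{u}}

/-! ### Finiteness of the images of reductions -/

theorem Gadget.replace_isFinite (γ : Gadget U T) {Y : Structure U} (hY : Y.IsFinite) :
    (γ.replace Y).IsFinite := by
  have : Finite Y.carrier := hY
  have := U.finite_ty
  have := U.finite_sym
  have (t : U.Ty) : Finite (Y.Dom t) := by unfold Structure.Dom; infer_instance
  have (R : U.Sym) : Finite (Y.rel R) := finite_rel hY R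
  have (j : Gadget.Index Y) : Finite (γ.piece Y j).carrier := by
    rcases j with a | c
    · exact γ.finite_D _
    · exact γ.finite_E _
  have : Finite (γ.pieces Y).carrier := by
    exact inferInstanceAs (Finite ((j : Gadget.Index Y) × (γ.piece Y j).carrier))
  exact Finite.of_surjective (Quot.mk _) Quot.mk_surjective

theorem DatalogProgram.Derives.map_ty {φ : DatalogProgram S} {X : Structure S} {P : φ.Idb}
    {w : List X.carrier} (hw : φ.Derives X P w) : w.map X.ty = φ.idbAr P := by
  cases hw with
  | rule r hr h typed edb idb eq =>
    rw [← r.head_typed, List.map_map]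
    exact List.map_congr_left fun x _ => typed x

theorem DatalogInterpretation.apply_isFinite (φ : DatalogInterpretation S U) {X : Structure S}
    (hX : X.IsFinite) : (φ.apply X).IsFinite := by
  have : Finite X.carrier := hX
  have := U.finite_ty
  have (t : U.Ty) : Finite ((φ.tyProg t).output X) := by
    exact (finite_lists_map_eq X.ty (φ.tyProg t).arity).subset
      fun w hw => DatalogProgram.Derives.map_ty hw
  unfold Structure.IsFinite DatalogInterpretation.apply
  infer_instance

theorem consistencyReduction_isFinite (k : ℕ) {A : Structure S} {B : Structure T}
    (hA : A.IsFinite) (hB : B.IsFinite) {X : Structure S} (hX : X.IsFinite) :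
    (consistencyReduction k A B X).IsFinite := by
  have : Finite X.carrier := hX
  have : Finite A.carrier := hA
  have (K : SmallSet X k) : Finite (B.power (consistentMaps k X A K)).carrier :=
    power_isFinite hB _
  have : Finite (consistencyPieces k A B X).carrier := by
    unfold consistencyPieces Structure.disjointUnion
    infer_instance
  exact Finite.of_surjective (Quot.mk _) Quot.mk_surjective

/-! ### Consistency and homomorphisms -/

theorem isPartialHom_restrict_hom {X A : Structure S} (h : Hom X A) (K : Finset X.carrier) :
    IsPartialHom X A K (fun x => h.toFun x.1) :=
  ⟨fun x => h.map_ty x.1, fun R w hw => by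
    simpa [List.map_map, Function.comp_def] using h.map_rel R _ hw⟩

/-- The restrictions of a homomorphism are partial homomorphisms and extend and restrict to one
another, so none of them can be the first to be removed. -/
theorem hom_mem_consistentMaps (k : ℕ) {X A : Structure S} (h : Hom X A) (K : SmallSet X k) :
    (fun x => h.toFun x.1) ∈ consistentMaps k X A K := by
  have key : ∀ (K : SmallSet X k) (f : K.1 → A.carrier), Removed k X A K f →
      f ≠ fun x => h.toFun x.1 := by
    intro K f hf
    induction hf with
    | not_hom K f hf => rintro rfl; exact hf (isPartialHom_restrict_hom h K.1)
    | not_extends L K hLK f hh ih => rintro rfl; exact ih (fun x => h.toFun x.1) rfl rfl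
    | not_restricts L K hLK g hg ih => rintro rfl; exact ih rfl
  exact fun hK => key K _ hK rfl

/-- Each power is evaluated at the coordinate `h|_K`. The identifications are respected because
restricting `h|_K` to `L` gives `h|_L`. -/
theorem consistencyReduction_mapsTo (k : ℕ) {X A : Structure S} (B : Structure T)
    (hXA : X.MapsTo A) : (consistencyReduction k A B X).MapsTo B := by
  obtain ⟨h⟩ := hXA
  refine ⟨Hom.glue _ (fun K => B.powerEval ⟨_, hom_mem_consistentMaps k h K⟩) ?_⟩
  rintro _ _ ⟨L, K, hLK, b⟩
  rfl

theorem isPartialHom_of_mem {k : ℕ} {X A : Structure S} {K : SmallSet X k} {f : K.1 → A.carrier}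
    (hf : f ∈ consistentMaps k X A K) : IsPartialHom X A K.1 f := by
  by_contra h
  exact hf (.not_hom K f h)

theorem exists_extension {k : ℕ} {X A : Structure S} {L K : SmallSet X k} (hLK : L.1 ⊆ K.1)
    {f : L.1 → A.carrier} (hf : f ∈ consistentMaps k X A L) :
    ∃ g ∈ consistentMaps k X A K, restrict hLK g = f := by
  by_contra! h
  exact hf (.not_extends L K hLK f fun g hg => by_contra fun hg' => h g hg' hg)

theorem restrict_mem {k : ℕ} {X A : Structure S} {L K : SmallSet X k} (hLK : L.1 ⊆ K.1)
    {g : K.1 → A.carrier} (hg : g ∈ consistentMaps k X A K) :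
    restrict hLK g ∈ consistentMaps k X A L :=
  (restrictMap k X A hLK ⟨g, hg⟩).2

/-! ### Transfer of Datalog derivations along consistent maps -/

/-- The set of the entries of a list. -/
noncomputable def support {α : Type u} (w : List α) : Finset α := by
  classical exact w.toFinset

@[simp]
theorem mem_support {α : Type u} {w : List α} {x : α} : x ∈ support w ↔ x ∈ w := by
  simp [support]

theorem card_support_map_le {α : Type u} {n : ℕ} (h : Fin n → α) (l : List (Fin n)) :
    (support (l.map h)).card ≤ n := by
  classical
  calc (support (l.map h)).card ≤ (Finset.univ.image h).card := by
        refine Finset.card_le_card fun x hx => ?_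
        rw [mem_support, List.mem_map] at hx
        obtain ⟨i, -, rfl⟩ := hx
        simp
    _ ≤ n := by simpa using Finset.card_image_le (s := Finset.univ) (f := h)

theorem DatalogProgram.Derives.card_support_le {φ : DatalogProgram S} {k : ℕ}
    (hφ : φ.WidthAtMost k) {X : Structure S} {P : φ.Idb} {w : List X.carrier}
    (hw : φ.Derives X P w) : (support w).card ≤ k := by
  cases hw with
  | rule r hr h typed edb idb eq => exact (card_support_map_le h _).trans (hφ r hr)

/-- Consistent maps send derivable facts to derivable facts. -/
theorem DatalogProgram.Derives.map_consistent {φ : DatalogProgram S} {k : ℕ}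
    (hφ : φ.WidthAtMost k) {X A : Structure S} {P : φ.Idb} {w : List X.carrier}
    (hw : φ.Derives X P w) (K : SmallSet X k) (f : K.1 → A.carrier)
    (hf : f ∈ consistentMaps k X A K) (xs : List K.1) (hxs : xs.map Subtype.val = w) :
    φ.Derives A P (xs.map f) := by
  induction hw generalizing K with
  | rule r hr h typed edb idb eq ih =>
    have hmem (i) : h i ∈ support ((List.finRange r.nvars).map h) := by simp
    -- `M` collects the elements of the whole rule instance, `L` those of its head. `K` contains `L`
    -- but need not be comparable with `M`, so `f` is restricted to `L` and then extended to `M`.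
    let M : SmallSet X k :=
      ⟨support ((List.finRange r.nvars).map h), (card_support_map_le h _).trans (hφ r hr)⟩
    let L : SmallSet X k :=
      ⟨support (r.headArgs.map h), (card_support_map_le h _).trans (hφ r hr)⟩
    have hLK : L.1 ⊆ K.1 := by
      intro x hx
      rw [mem_support, ← hxs, List.mem_map] at hx
      obtain ⟨y, -, rfl⟩ := hx
      exact y.2
    have hLM : L.1 ⊆ M.1 := by
      intro x hx
      rw [mem_support, List.mem_map] at hx
      obtain ⟨i, -, rfl⟩ := hx
      exact hmem i
    obtain ⟨g, hg, hgf⟩ := exists_extension hLM (restrict_mem hLK hf)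
    have hgf' (x : X.carrier) (hxL : x ∈ L.1) : g ⟨x, hLM hxL⟩ = f ⟨x, hLK hxL⟩ :=
      congrFun hgf ⟨x, hxL⟩
    let h' : Fin r.nvars → M.1 := fun i => ⟨h i, hmem i⟩
    have hmap (l : List (Fin r.nvars)) : (l.map h').map Subtype.val = l.map h := by
      rw [List.map_map]; rfl
    have hhead : xs.map f = r.headArgs.map (g ∘ h') := by
      have hlen : xs.length = r.headArgs.length := by simpa using congrArg List.length hxs
      refine List.ext_getElem (by simpa using hlen) fun i h1 h2 => ?_
      simp only [List.length_map] at h1 h2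
      have hi : (xs[i]).1 = h (r.headArgs[i]) := by
        have := List.getElem_of_eq hxs (i := i) (by simpa using h1)
        simpa using this
      have hiL : h (r.headArgs[i]) ∈ L.1 := by
        rw [mem_support]; exact List.mem_map_of_mem (List.getElem_mem h2)
      simp only [List.getElem_map, Function.comp_apply]
      refine Eq.trans ?_ (hgf' _ hiL).symm
      exact congrArg f (Subtype.ext hi)
    rw [hhead]
    have hpg := isPartialHom_of_mem hg
    -- The same rule fires in `A` under `g ∘ h'`: EDB atoms hold since `g` is a partial
    -- homomorphism, IDB atoms by induction applied to `M` and `g`.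
    refine .rule r hr (g ∘ h') (fun x => (hpg.1 _).trans (typed x)) ?_ ?_ ?_
    · intro R args ht ha
      rw [← List.map_map]
      exact hpg.2 R _ (by rw [hmap]; exact edb R args ht ha)
    · intro Q args ht ha
      rw [← List.map_map]
      exact ih Q args ht ha M g hg _ (hmap args)
    · intro x y ht ha
      exact congrArg g (Subtype.ext (eq x y ht ha))

/-! ### Interpretations with gadgets map to the consistency reduction -/

theorem map_pmap_of_eq {α β δ : Type*} {p : α → Prop} {push : ∀ a, p a → β} (s : α → δ)
    (s' : β → δ) (h : ∀ a ha, s' (push a ha) = s a) (v : List α) (hv : ∀ a ∈ v, p a) :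
    (v.pmap push hv).map s' = v.map s := by
  simp [List.map_pmap, h]

/-- Relations of `φ(X)` are tested on concatenations, while a consistent map acts on tuples entry by
entry; this reconciles the two. -/
theorem flatMap_pmap_attachWith {α β V W : Type*} {p : V → Prop} (val : α → List V)
    (val' : β → List W) (f : {x // p x} → W) (push : ∀ a, (∀ y ∈ val a, p y) → β)
    (hpush : ∀ a h, val' (push a h) = ((val a).attachWith p h).map f) (v : List α)
    (hv : ∀ a ∈ v, ∀ y ∈ val a, p y) (hv' : ∀ y ∈ v.flatMap val, p y) :
    (v.pmap push hv).flatMap val' = ((v.flatMap val).attachWith p hv').map f := by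
  induction v with
  | nil => rfl
  | cons a v ih =>
    simp only [List.pmap_cons, List.flatMap_cons]
    rw [ih (fun b hb => hv b (by simp [hb])) fun y hy => hv' y (by simp [hy])]
    simp [hpush, List.attachWith, List.pmap_append]

namespace DatalogInterpretation

variable {k : ℕ} {φ : DatalogInterpretation S U} {X A : Structure S}

/-- The image of an element of `φ(X)` under a consistent map. -/
def pushElement (hφ : φ.WidthAtMost k) {K : SmallSet X k} (f : consistentMaps k X A K)
    (a : (φ.apply X).carrier) (ha : ∀ y ∈ a.2.1, y ∈ K.1) : (φ.apply A).carrier :=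
  ⟨a.1, (a.2.1.attachWith (· ∈ K.1) ha).map f.1,
    DatalogProgram.Derives.map_consistent (hφ.1 a.1) a.2.2 K f.1 f.2 _
      (List.attachWith_map_subtype_val ha)⟩

/-- This compatibility matches the identifications in `γ(φ(X))`, between a tuple and its entries,
with those along `L ⊆ K` in `κ_k(X)`. -/
theorem pushElement_restrict (hφ : φ.WidthAtMost k) {L K : SmallSet X k} (hLK : L.1 ⊆ K.1)
    (f : consistentMaps k X A K) (a : (φ.apply X).carrier) (hK : ∀ y ∈ a.2.1, y ∈ K.1)
    (hL : ∀ y ∈ a.2.1, y ∈ L.1) :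
    pushElement hφ f a hK = pushElement hφ (restrictMap k X A hLK f) a hL := by
  refine congrArg (Sigma.mk a.1) (Subtype.ext ?_)
  refine List.ext_getElem (by simp) fun i h1 h2 => ?_
  simp [restrictMap, restrict]

/-- The image of a tuple in a relation of `φ(X)` under a consistent map. -/
def pushTuple (hφ : φ.WidthAtMost k) {K : SmallSet X k} (f : consistentMaps k X A K)
    {R : U.Sym} (w : (φ.apply X).rel R) (hw : ∀ a ∈ w.1, ∀ y ∈ a.2.1, y ∈ K.1) :
    (φ.apply A).rel R :=
  ⟨w.1.pmap (pushElement hφ f) hw, by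
    have hw' : ∀ y ∈ w.1.flatMap (fun a => (a.2 : List X.carrier)), y ∈ K.1 := by
      intro y hy
      obtain ⟨a, ha, hya⟩ := List.mem_flatMap.1 hy
      exact hw a ha y hya
    refine ⟨?_, ?_⟩
    · exact (map_pmap_of_eq (push := pushElement hφ f) Sigma.fst Sigma.fst (fun _ _ => rfl) _ _).trans w.2.1
    · have := DatalogProgram.Derives.map_consistent (hφ.2 R) w.2.2 K f.1 f.2 _
        (List.attachWith_map_subtype_val hw')
      rwa [← flatMap_pmap_attachWith (fun a : (φ.apply X).carrier => (a.2 : List X.carrier))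
        (fun a : (φ.apply A).carrier => (a.2 : List A.carrier)) f.1 (pushElement hφ f)
        (fun _ _ => rfl) w.1 hw hw'] at this⟩

/-- The elements of `X` that a copy of a gadget piece in `γ(φ(X))` involves. -/
def indexSupport : Gadget.Index (φ.apply X) → List X.carrier
  | .inl a => a.2.1.2.1
  | .inr c => c.2.1.flatMap fun a => (a.2 : List X.carrier)

/-- Every derived tuple is an instance of a rule head, so its entries are values of at most `k`
variables. For a constraint this bounds the whole concatenation. -/
theorem card_indexSupport_le (hφ : φ.WidthAtMost k) (j : Gadget.Index (φ.apply X)) :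
    (support (indexSupport j)).card ≤ k := by
  rcases j with a | c
  · exact DatalogProgram.Derives.card_support_le (hφ.1 _) a.2.1.2.2
  · exact DatalogProgram.Derives.card_support_le (hφ.2 _) c.2.2.2

/-- The homomorphism to `B` from a copy of a gadget piece in `γ(φ(X))` that a consistent map induces:
the corresponding copy in `γ(φ(A))` is included and mapped by `g`. -/
def indexHom (γ : Gadget U T) {B : Structure T} (g : Hom (γ.replace (φ.apply A)) B)
    (hφ : φ.WidthAtMost k) {K : SmallSet X k} (f : consistentMaps k X A K) :
    (j : Gadget.Index (φ.apply X)) → (∀ y ∈ indexSupport j, y ∈ K.1) →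
      Hom (γ.piece (φ.apply X) j) B
  | .inl a, h => g.comp (Hom.incl (Z := γ.piece (φ.apply A)) _
      (.inl ⟨a.1, pushElement hφ f a.2.1 h, a.2.2⟩))
  | .inr c, h => g.comp (Hom.incl (Z := γ.piece (φ.apply A)) _
      (.inr ⟨c.1, pushTuple hφ f c.2 fun a ha y hy =>
        h y (List.mem_flatMap.2 ⟨a, ha, hy⟩)⟩))

/-- If `γ(φ(A))` maps to `B`, then `γ(φ(X))` maps to the `k`-consistency reduction of `X`. -/
theorem replace_apply_mapsTo (γ : Gadget U T) {B : Structure T}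
    (hAB : (γ.replace (φ.apply A)).MapsTo B) (hφ : φ.WidthAtMost k) (X : Structure S) :
    (γ.replace (φ.apply X)).MapsTo (consistencyReduction k A B X) := by
  obtain ⟨g⟩ := hAB
  let supp (j : Gadget.Index (φ.apply X)) : SmallSet X k := ⟨_, card_indexSupport_le hφ j⟩
  let toPiece (j) : Hom (γ.piece (φ.apply X) j) (B.power (consistentMaps k X A (supp j))) :=
    Hom.toPower fun f => indexHom γ g hφ f j fun y hy => mem_support.2 hy
  refine ⟨Hom.glue _ (fun j => (Hom.incl
    (Z := fun K : SmallSet X k => B.power (consistentMaps k X A K)) _ (supp j)).comp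
      (toPiece j)) ?_⟩
  rintro _ _ ⟨R, w, i, e⟩
  have hsub : (supp (.inl ⟨(U.ar R).get i, (φ.apply X).entry w i⟩)).1 ⊆ (supp (.inr ⟨R, w⟩)).1 := by
    intro y hy
    rw [mem_support] at hy ⊢
    exact List.mem_flatMap.2 ⟨_, List.get_mem _ _, hy⟩
  -- The entry's image is moved to the larger set of the constraint; it remains to compare the two
  -- at each coordinate `f`, where the gluing in `γ(φ(A))` applies.
  refine Eq.trans ?_ (Quot.sound (ConsistencyGlue.intro _ _ hsub
    ((toPiece (.inl ⟨(U.ar R).get i, (φ.apply X).entry w i⟩)).toFun e)))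
  refine congrArg (fun b => Quot.mk _ (⟨_, b⟩ : (consistencyPieces k A B X).carrier)) ?_
  refine power_ext ((γ.p R i).map_ty e) fun f => congrArg g.toFun ?_
  refine (Quot.sound (Gadget.Glue.intro R _ i e)).trans ?_
  refine congrArg (fun a => Quot.mk _
    (⟨.inl ⟨(U.ar R).get i, a⟩, e⟩ : (γ.pieces (φ.apply A)).carrier)) (Subtype.ext ?_)
  refine (List.getElem_pmap _ _ _).trans ?_
  exact pushElement_restrict hφ hsub f _ _ _

end DatalogInterpretation

/-! ### The canonical Datalog program -/

instance Atom.finite {n : ℕ} (varTy : Fin n → S.Ty) : Finite (Atom S varTy) := by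
  have := S.finite_sym
  have (R : S.Sym) : Finite {l : List (Fin n) // l.map varTy = S.ar R} :=
    finite_lists_map_eq varTy (S.ar R)
  let f : ((R : S.Sym) × {l : List (Fin n) // l.map varTy = S.ar R}) ⊕
      {p : Fin n × Fin n // varTy p.1 = varTy p.2} → Atom S varTy :=
    Sum.elim (fun a => .rel a.1 a.2.1 a.2.2) (fun p => .eq p.1.1 p.1.2 p.2)
  refine Finite.of_surjective f ?_
  rintro (⟨R, l, h⟩ | ⟨x, y, h⟩)
  · exact ⟨.inl ⟨R, l, h⟩, rfl⟩
  · exact ⟨.inr ⟨(x, y), h⟩, rfl⟩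

/-- Bounding the number of variables alone would not suffice: bodies are lists and may repeat atoms.
-/
theorem finite_rules_bounded (Idb : Type u) [Finite Idb] (idbAr : Idb → List S.Ty) (k m : ℕ) :
    {r : Rule S Idb idbAr | r.nvars ≤ k ∧ r.body.length ≤ m}.Finite := by
  have := S.finite_ty
  have (n : ℕ) (τ : Fin n → S.Ty) (P : Idb) :
      Finite {l : List (Fin n) // l.map τ = idbAr P} := finite_lists_map_eq τ (idbAr P)
  have (n : ℕ) (τ : Fin n → S.Ty) :
      Finite {b : List (Atom (S.extend Idb idbAr) τ) // b.length ≤ m} :=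
    have : Finite (Atom (S.extend Idb idbAr) τ) := Atom.finite (S := S.extend Idb idbAr) τ
    List.finite_length_le _ m
  let f : (Σ (n : Fin (k + 1)) (τ : Fin n → S.Ty) (P : Idb),
      {c : {l : List (Fin n) // l.map τ = idbAr P} ×
        {b : List (Atom (S.extend Idb idbAr) τ) // b.length ≤ m} //
          ∀ x : Fin n, x ∈ c.1.1 ∨ ∃ a ∈ c.2.1, x ∈ a.vars}) → Rule S Idb idbAr :=
    fun z => ⟨z.1, z.2.1, z.2.2.1, z.2.2.2.1.1.1, z.2.2.2.1.1.2, z.2.2.2.1.2.1, z.2.2.2.2⟩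
  refine (Set.finite_range f).subset ?_
  rintro ⟨n, τ, P, l, hl, b, hb⟩ ⟨hn, hm⟩
  exact ⟨⟨⟨n, Nat.lt_succ_of_le hn⟩, τ, P, ⟨⟨l, hl⟩, ⟨b, hm⟩⟩, hb⟩, rfl⟩

/-- The IDBs of the canonical program: a tuple of at most `k` types and a set of tuples of elements
of `A`, which bounds the consistent images of the tuples in the IDB. -/
structure CanonicalIdb (k : ℕ) (A : Structure S) : Type u where
  n : ℕ
  le : n ≤ k
  types : Fin n → S.Ty
  vals : Set (Fin n → A.carrier)

namespace CanonicalIdb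

variable {k : ℕ} {A : Structure S}

theorem finite (k : ℕ) (hA : A.IsFinite) : Finite (CanonicalIdb k A) := by
  have : Finite A.carrier := hA
  have := S.finite_ty
  let f : (Σ n : Fin (k + 1), (Fin n → S.Ty) × Set (Fin n → A.carrier)) → CanonicalIdb k A :=
    fun z => ⟨z.1, Nat.le_of_lt_succ z.1.2, z.2.1, z.2.2⟩
  refine Finite.of_surjective f ?_
  rintro ⟨n, h, τ, F⟩
  exact ⟨⟨⟨n, Nat.lt_succ_of_le h⟩, τ, F⟩, rfl⟩

/-- The arity of an IDB. -/
def arity (P : CanonicalIdb k A) : List S.Ty := List.ofFn P.types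

/-- The intended interpretation of an IDB in `A`. -/
def Holds (P : CanonicalIdb k A) (w : List A.carrier) : Prop := ∃ c ∈ P.vals, List.ofFn c = w

end CanonicalIdb

/-- A rule over the canonical IDBs is sound if it is valid in `A` under the intended
interpretation of the IDBs. -/
def SoundRule {k : ℕ} {A : Structure S} [Finite (CanonicalIdb k A)]
    (r : Rule S (CanonicalIdb k A) CanonicalIdb.arity) : Prop :=
  ∀ h : Fin r.nvars → A.carrier, (∀ x, A.ty (h x) = r.varTy x) →
    (∀ R args ht, Atom.rel (Sum.inl R) args ht ∈ r.body → args.map h ∈ A.rel R) →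
    (∀ P args ht, Atom.rel (Sum.inr P) args ht ∈ r.body → P.Holds (args.map h)) →
    (∀ x y ht, Atom.eq x y ht ∈ r.body → h x = h y) →
    r.head.Holds (r.headArgs.map h)

/-- The canonical program of width `k` for `A` with output `P`: all the sound rules with at most `k`
variables and at most two atoms in the body. -/
def canonicalProgram {k : ℕ} {A : Structure S} [Finite (CanonicalIdb k A)] (P : CanonicalIdb k A) :
    DatalogProgram S where
  Idb := CanonicalIdb k A
  idbAr := CanonicalIdb.arity
  rules := {r | (r.nvars ≤ k ∧ r.body.length ≤ 2) ∧ SoundRule r}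
  finite_rules := (finite_rules_bounded _ _ k 2).subset fun _ hr => hr.1
  out := P

theorem Atom.rel_inl_ne_rel_inr {Idb : Type u} [Finite Idb] {idbAr : Idb → List S.Ty} {n : ℕ}
    {varTy : Fin n → S.Ty} {R : S.Sym} {P : Idb} {v w : List (Fin n)}
    {hv : v.map varTy = (S.extend Idb idbAr).ar (.inl R)}
    {hw : w.map varTy = (S.extend Idb idbAr).ar (.inr P)} :
    (Atom.rel (S := S.extend Idb idbAr) (.inl R) v hv : Atom (S.extend Idb idbAr) varTy) ≠
      Atom.rel (S := S.extend Idb idbAr) (.inr P) w hw := by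
  intro h
  cases h

/-! ### Simulating the consistency removals by derivations -/

section Canonical

variable {k : ℕ} {A : Structure S}

/-- The IDB that bounds the consistent maps on `K` by the property `p`. -/
noncomputable def idbOf {X : Structure S} (K : SmallSet X k) (p : (K.1 → A.carrier) → Prop) :
    CanonicalIdb k A where
  n := K.1.card
  le := K.2
  types i := X.ty (K.1.equivFin.symm i).1
  vals := {c | p (c ∘ K.1.equivFin)}

/-- The canonical enumeration of `K`. -/
noncomputable def enum {X : Structure S} (K : SmallSet X k) : List X.carrier :=
  List.ofFn fun i => (K.1.equivFin.symm i).1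

/-- The inclusion of `L` in `K` in terms of the canonical enumerations. -/
noncomputable def position {X : Structure S} {L K : SmallSet X k} (hLK : L.1 ⊆ K.1) :
    Fin L.1.card → Fin K.1.card :=
  fun j => K.1.equivFin ⟨(L.1.equivFin.symm j).1, hLK (L.1.equivFin.symm j).2⟩

variable {X : Structure S}

theorem equivFin_symm_position {L K : SmallSet X k} (hLK : L.1 ⊆ K.1) (j) :
    (K.1.equivFin.symm (position hLK j)).1 = (L.1.equivFin.symm j).1 := by
  simp [position]

theorem map_position_types {L K : SmallSet X k} (hLK : L.1 ⊆ K.1)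
    (p : (L.1 → A.carrier) → Prop) :
    (List.ofFn (position hLK)).map (fun i => X.ty (K.1.equivFin.symm i).1) =
      (idbOf L p).arity := by
  rw [List.map_ofFn]
  exact congrArg List.ofFn (funext fun j => congrArg X.ty (equivFin_symm_position hLK j))

theorem map_position_enum {L K : SmallSet X k} (hLK : L.1 ⊆ K.1) :
    (List.ofFn (position hLK)).map (fun i => (K.1.equivFin.symm i).1) = enum L := by
  rw [List.map_ofFn]
  exact congrArg List.ofFn (funext fun j => equivFin_symm_position hLK j)

/-- This translates between tuples indexed by `Fin` and maps on sets: selecting the positions of `L`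
is restriction to `L`. -/
theorem comp_position {α : Type u} {L K : SmallSet X k} (hLK : L.1 ⊆ K.1)
    (h : Fin K.1.card → α) :
    (h ∘ position hLK) ∘ L.1.equivFin = restrict hLK (h ∘ K.1.equivFin) := by
  funext x
  simp [position, restrict]

theorem holds_map_position {L K : SmallSet X k} (hLK : L.1 ⊆ K.1)
    (p : (L.1 → A.carrier) → Prop) (h : Fin K.1.card → A.carrier) :
    (idbOf L p).Holds ((List.ofFn (position hLK)).map h) ↔
      p (restrict hLK (h ∘ K.1.equivFin)) := by
  rw [List.map_ofFn, ← comp_position]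
  constructor
  · rintro ⟨c, hc, h⟩
    rw [List.ofFn_injective h] at hc
    exact hc
  · exact fun hp => ⟨_, hp, rfl⟩

theorem mem_position_self (K : SmallSet X k) (x : Fin K.1.card) :
    x ∈ List.ofFn (position (subset_refl K.1)) := by
  rw [List.mem_ofFn]
  exact ⟨x, by simp [position]⟩

variable [Finite (CanonicalIdb k A)]

/-- The intended interpretation is closed under all sound rules, hence contains the least fixed
point on `A`. -/
theorem canonicalProgram_holds {P : CanonicalIdb k A} {Q : (canonicalProgram P).Idb}
    {w : List A.carrier} (hw : (canonicalProgram P).Derives A Q w) :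
    CanonicalIdb.Holds (k := k) Q w := by
  induction hw with
  | rule r hr h typed edb idb eq ih => exact hr.2 h typed edb ih eq

theorem derives_out_irrel {P P' : CanonicalIdb k A} {Q : (canonicalProgram P).Idb} {X : Structure S} {w : List X.carrier}
    (hw : (canonicalProgram P).Derives X Q w) : (canonicalProgram P').Derives X Q w := by
  induction hw with
  | rule r hr h typed edb idb eq ih =>
    exact DatalogProgram.Derives.rule (φ := canonicalProgram P') r hr h typed edb ih eq

/-- The canonical program derives that the consistent maps on `K` have the property `p`. -/
def Bounds (K : SmallSet X k) (p : (K.1 → A.carrier) → Prop) : Prop :=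
  (canonicalProgram (idbOf K p)).Derives X (idbOf K p) (enum K)

/-- A derivation by a rule whose variables are the elements of `K`. -/
theorem bounds_of_rule {L K : SmallSet X k} (hLK : L.1 ⊆ K.1) (q : (L.1 → A.carrier) → Prop)
    (body : List (Atom (S.extend (CanonicalIdb k A) CanonicalIdb.arity)
      fun i => X.ty (K.1.equivFin.symm i).1))
    (hbody : body.length ≤ 2)
    (occurs : ∀ x, x ∈ List.ofFn (position hLK) ∨ ∃ a ∈ body, x ∈ a.vars)
    (sound : ∀ g : K.1 → A.carrier, (∀ x, A.ty (g x) = X.ty x.1) →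
      (∀ R args ht, Atom.rel (Sum.inl R) args ht ∈ body →
        args.map (g ∘ K.1.equivFin.symm) ∈ A.rel R) →
      (∀ P args ht, Atom.rel (Sum.inr P) args ht ∈ body →
        P.Holds (args.map (g ∘ K.1.equivFin.symm))) →
      q (restrict hLK g))
    (edb : ∀ R args ht, Atom.rel (Sum.inl R) args ht ∈ body →
      args.map (fun i => (K.1.equivFin.symm i).1) ∈ X.rel R)
    (idb : ∀ P args ht, Atom.rel (Sum.inr P) args ht ∈ body →
      (canonicalProgram P).Derives X P (args.map (fun i => (K.1.equivFin.symm i).1)))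
    (eq : ∀ x y ht, Atom.eq x y ht ∉ body) :
    Bounds L q := by
  unfold Bounds
  rw [← map_position_enum hLK]
  refine DatalogProgram.Derives.rule (φ := canonicalProgram (idbOf L q))
    ⟨K.1.card, fun i => X.ty (K.1.equivFin.symm i).1, idbOf L q, List.ofFn (position hLK),
      map_position_types hLK q, body, occurs⟩ ⟨⟨K.2, hbody⟩, ?_⟩ _ (fun _ => rfl) edb
      (fun P args ht ha => derives_out_irrel (P := P) (Q := P) (idb P args ht ha))
      (fun x y ht ha => (eq x y ht ha).elim)
  intro h typed hedb hidb _
  have hh : (h ∘ K.1.equivFin) ∘ K.1.equivFin.symm = h := by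
    funext i
    simp
  refine (holds_map_position hLK q h).2 (sound (h ∘ K.1.equivFin) ?_ ?_ ?_)
  · intro x
    simpa using typed (K.1.equivFin x)
  · rw [hh]; exact hedb
  · rw [hh]; exact hidb

theorem bounds_of_typed {K : SmallSet X k} {p : (K.1 → A.carrier) → Prop}
    (hp : ∀ g, (∀ x, A.ty (g x) = X.ty x.1) → p g) : Bounds K p :=
  bounds_of_rule (subset_refl _) p [] (by simp) (fun x => .inl (mem_position_self K x))
    (fun g hg _ _ => hp g hg) (by simp) (by simp) (by simp)

theorem bounds_of_rel {K : SmallSet X k} {p : (K.1 → A.carrier) → Prop} (R : S.Sym)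
    (w : List K.1) (hw : w.map Subtype.val ∈ X.rel R) (hp : ∀ g, w.map g ∈ A.rel R → p g) :
    Bounds K p := by
  have hmap {α : Type u} (g : K.1 → α) : (w.map K.1.equivFin).map (g ∘ K.1.equivFin.symm)
      = w.map g := by
    simp [List.map_map, Function.comp_def]
  have ht : (w.map K.1.equivFin).map (fun i => X.ty (K.1.equivFin.symm i).1) = S.ar R := by
    rw [← X.rel_typed R _ hw, List.map_map, List.map_map]
    simp [Function.comp_def]
  refine bounds_of_rule (subset_refl _) p [.rel (.inl R) (w.map K.1.equivFin) ht] (by simp)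
    (fun x => .inl (mem_position_self K x)) (fun g hg h _ => hp g ?_) ?_
    (fun _ _ _ ha => (Atom.rel_inl_ne_rel_inr (List.mem_singleton.1 ha).symm).elim) (by simp)
  · rw [← hmap g]
    exact h R _ ht (by simp)
  · intro R' args ht' ha
    cases List.mem_singleton.1 ha
    have := hmap (Subtype.val : K.1 → X.carrier)
    rw [← this] at hw
    exact hw

theorem Bounds.extend {L K : SmallSet X k} (hLK : L.1 ⊆ K.1) {q : (L.1 → A.carrier) → Prop}
    {p : (K.1 → A.carrier) → Prop} (h : Bounds L q) (hp : ∀ g, q (restrict hLK g) → p g) :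
    Bounds K p := by
  refine bounds_of_rule (subset_refl _) p
    [.rel (.inr (idbOf L q)) (List.ofFn (position hLK)) (map_position_types hLK q)] (by simp)
    (fun x => .inl (mem_position_self K x)) (fun g hg _ hidb => hp g ?_)
    (fun _ _ _ ha => (Atom.rel_inl_ne_rel_inr (List.mem_singleton.1 ha)).elim) ?_ (by simp)
  · have := (holds_map_position hLK q _).1
      (hidb (idbOf L q) _ (map_position_types hLK q) (by simp))
    simpa [Function.comp_assoc] using this
  · intro P args ht ha
    cases List.mem_singleton.1 ha
    rw [map_position_enum]
    exact h

/-- The rule quantifies over all of `K` although its head mentions only `L`; the remaining variables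
occur in the body atom. -/
theorem Bounds.project {L K : SmallSet X k} (hLK : L.1 ⊆ K.1) {q : (L.1 → A.carrier) → Prop}
    {p : (K.1 → A.carrier) → Prop} (h : Bounds K p) (hq : ∀ g, p g → q (restrict hLK g)) :
    Bounds L q := by
  refine bounds_of_rule hLK q
    [.rel (.inr (idbOf K p)) (List.ofFn (position (subset_refl K.1)))
      (map_position_types (subset_refl K.1) p)] (by simp)
    (fun x => .inr ⟨_, List.mem_singleton_self _, mem_position_self K x⟩)
    (fun g hg _ hidb => hq g ?_)
    (fun _ _ _ ha => (Atom.rel_inl_ne_rel_inr (List.mem_singleton.1 ha)).elim) ?_ (by simp)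
  · have : p ((g ∘ K.1.equivFin.symm) ∘ K.1.equivFin) :=
      (holds_map_position (subset_refl K.1) p _).1
        (hidb (idbOf K p) _ (map_position_types (subset_refl K.1) p) (by simp))
    simpa [Function.comp_assoc] using this
  · intro P args ht ha
    cases List.mem_singleton.1 ha
    rw [map_position_enum]
    exact h

theorem Bounds.mono {K : SmallSet X k} {p q : (K.1 → A.carrier) → Prop} (h : Bounds K p)
    (hpq : ∀ g, p g → q g) : Bounds K q :=
  h.extend (subset_refl _) hpq

/-- This is the only use of a body with two atoms. Larger finite conjunctions come from iterating
it, so the bound on bodies can stay at two. -/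
theorem Bounds.and {K : SmallSet X k} {p q : (K.1 → A.carrier) → Prop} (hp : Bounds K p)
    (hq : Bounds K q) : Bounds K fun g => p g ∧ q g := by
  refine bounds_of_rule (subset_refl _) _
    [.rel (.inr (idbOf K p)) (List.ofFn (position (subset_refl K.1)))
      (map_position_types (subset_refl K.1) p),
     .rel (.inr (idbOf K q)) (List.ofFn (position (subset_refl K.1)))
      (map_position_types (subset_refl K.1) q)] (by simp)
    (fun x => .inl (mem_position_self K x))
    (fun g hg _ hidb => ⟨?_, ?_⟩)
    (fun _ _ _ ha => ((List.mem_pair.1 ha).elim Atom.rel_inl_ne_rel_inr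
      Atom.rel_inl_ne_rel_inr).elim) ?_ (by simp)
  · have : p ((g ∘ K.1.equivFin.symm) ∘ K.1.equivFin) :=
      (holds_map_position (subset_refl K.1) p _).1
        (hidb (idbOf K p) _ (map_position_types (subset_refl K.1) p) (by simp))
    change p g
    simpa [Function.comp_assoc] using this
  · have : q ((g ∘ K.1.equivFin.symm) ∘ K.1.equivFin) :=
      (holds_map_position (subset_refl K.1) q _).1
        (hidb (idbOf K q) _ (map_position_types (subset_refl K.1) q) (by simp))
    change q g
    simpa [Function.comp_assoc] using this
  · intro P args ht ha
    obtain ha | ha := List.mem_pair.1 ha <;> cases ha <;> rw [map_position_enum]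
    · exact hp
    · exact hq

theorem Bounds.forall_mem {K : SmallSet X k} {ι : Type*} (s : Finset ι)
    (p : ι → (K.1 → A.carrier) → Prop) (h : ∀ i ∈ s, Bounds K (p i)) :
    Bounds K fun g => ∀ i ∈ s, p i g := by
  classical
  induction s using Finset.induction_on with
  | empty => exact bounds_of_typed (by simp)
  | insert i s hi ih =>
    refine ((h i (by simp)).and (ih fun j hj => h j (by simp [hj]))).mono fun g hg => ?_
    simpa using hg

theorem Bounds.not_mem (hA : A.IsFinite) {K : SmallSet X k} (s : Set (K.1 → A.carrier))
    (h : ∀ f ∈ s, Bounds K (· ≠ f)) : Bounds K (· ∉ s) := by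
  have : Finite A.carrier := hA
  have hs : s.Finite := s.toFinite
  refine (Bounds.forall_mem hs.toFinset (fun f g => g ≠ f)
    fun f hf => h f (hs.mem_toFinset.1 hf)).mono fun g hg hgs => ?_
  exact hg g (hs.mem_toFinset.2 hgs) rfl

/-- Each way of removing a map is matched by sound rules: a violated type or constraint of `X` by a
rule without IDBs, failure to extend by conjunction and projection, failure of a restriction by
extension. -/
theorem Removed.bounds (hA : A.IsFinite) {K : SmallSet X k} {f : K.1 → A.carrier}
    (hf : Removed k X A K f) : Bounds K (· ≠ f) := by
  induction hf with
  | not_hom K f hf =>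
    by_cases ht : ∀ x, A.ty (f x) = X.ty x.1
    · obtain ⟨R, w, hw, hwf⟩ : ∃ (R : S.Sym) (w : List K.1), w.map Subtype.val ∈ X.rel R ∧
          w.map f ∉ A.rel R := by
        by_contra! h
        exact hf ⟨ht, h⟩
      refine bounds_of_rel R w hw ?_
      rintro g hg rfl
      exact hwf hg
    · refine bounds_of_typed ?_
      rintro g hg rfl
      exact ht hg
  | not_extends L K hLK h hh ih =>
    -- All extensions of `h` to `K` are excluded, so no remaining map on `K` restricts to `h`.
    exact (Bounds.not_mem hA {g | restrict hLK g = h} ih).project hLK fun g hg => hg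
  | not_restricts L K hLK g hg ih =>
    refine ih.extend hLK ?_
    rintro g' hg' rfl
    exact hg' rfl

/-- The canonical program derives the consistent maps. -/
theorem bounds_consistentMaps (hA : A.IsFinite) (K : SmallSet X k) :
    Bounds K (· ∈ consistentMaps k X A K) :=
  Bounds.not_mem hA {f | Removed k X A K f} fun _ hf => Removed.bounds hA hf

end Canonical

/-! ### The canonical interpretation and gadget -/

/-- The symbols of the intermediate signature. -/
structure CanonicalSym (k : ℕ) (A : Structure S) : Type u where
  source : CanonicalIdb k A
  target : CanonicalIdb k A
  pos : Fin target.n → Fin source.n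
  types_pos : ∀ j, source.types (pos j) = target.types j
  vals_pos : ∀ c ∈ source.vals, c ∘ pos ∈ target.vals

theorem CanonicalSym.finite (k : ℕ) {A : Structure S} (hA : A.IsFinite) :
    Finite (CanonicalSym k A) := by
  have := CanonicalIdb.finite k hA
  let f : (Σ (c d : CanonicalIdb k A), {σ : Fin d.n → Fin c.n //
      (∀ j, c.types (σ j) = d.types j) ∧ ∀ v ∈ c.vals, v ∘ σ ∈ d.vals}) → CanonicalSym k A :=
    fun z => ⟨z.1, z.2.1, z.2.2.1, z.2.2.2.1, z.2.2.2.2⟩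
  refine Finite.of_surjective f ?_
  rintro ⟨c, d, σ, h, h'⟩
  exact ⟨⟨c, d, σ, h, h'⟩, rfl⟩

/-- The intermediate signature. -/
def canonicalSignature (k : ℕ) {A : Structure S} (hA : A.IsFinite) : Signature.{u} where
  Ty := CanonicalIdb k A
  Sym := CanonicalSym k A
  ar R := [R.source, R.target]
  finite_ty := CanonicalIdb.finite k hA
  finite_sym := CanonicalSym.finite k hA

/-- The program without recursion that outputs the pairs of a tuple and its subtuple. -/
def subtupleProgram {k : ℕ} {A : Structure S} (R : CanonicalSym k A) : DatalogProgram S where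
  Idb := PUnit
  idbAr _ := R.source.arity ++ R.target.arity
  rules := {{
    nvars := R.source.n
    varTy := R.source.types
    head := PUnit.unit
    headArgs := List.ofFn id ++ List.ofFn R.pos
    head_typed := by
      rw [List.map_append, List.map_ofFn, List.map_ofFn]
      exact congrArg (R.source.arity ++ ·) (congrArg List.ofFn (funext R.types_pos))
    body := []
    occurs := fun x => .inl (List.mem_append_left _ (by simp [List.mem_ofFn])) }}
  finite_rules := Set.finite_singleton _
  out := PUnit.unit

theorem mem_subtupleProgram_output {k : ℕ} {A : Structure S} {R : CanonicalSym k A}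
    {X : Structure S} {w : List X.carrier} :
    w ∈ (subtupleProgram R).output X ↔ ∃ h : Fin R.source.n → X.carrier,
      (∀ i, X.ty (h i) = R.source.types i) ∧ w = List.ofFn h ++ List.ofFn (h ∘ R.pos) := by
  constructor
  · rintro ⟨r, rfl, h, typed, -, -, -⟩
    exact ⟨h, typed, by simp [List.map_ofFn]⟩
  · rintro ⟨h, typed, rfl⟩
    have := DatalogProgram.Derives.rule (φ := subtupleProgram R) (X := X) _ rfl h typed
      (fun _ _ _ ha => (List.not_mem_nil ha).elim) (fun _ _ _ ha => (List.not_mem_nil ha).elim)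
      (fun _ _ _ ha => (List.not_mem_nil ha).elim)
    rw [List.map_append, List.map_ofFn, List.map_ofFn] at this
    exact this

/-- The canonical Datalog interpretation. -/
def canonicalInterpretation (k : ℕ) {A : Structure S} (hA : A.IsFinite) :
    DatalogInterpretation S (canonicalSignature k hA) where
  tyProg P := @canonicalProgram S k A (CanonicalIdb.finite k hA) P
  symProg R := subtupleProgram R
  arity_eq R := by
    change R.source.arity ++ R.target.arity = R.source.arity ++ (R.target.arity ++ [])
    rw [List.append_nil]

theorem canonicalInterpretation_width (k : ℕ) {A : Structure S} (hA : A.IsFinite) :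
    (canonicalInterpretation k hA).WidthAtMost k := by
  refine ⟨fun P r hr => hr.1.1, fun R r hr => ?_⟩
  obtain rfl := hr
  exact R.source.le

/-- The homomorphism of gadget pieces for each coordinate of a symbol. -/
def canonicalGadgetHom {k : ℕ} {A : Structure S} (B : Structure T) (R : CanonicalSym k A) :
    (i : Fin [R.source, R.target].length) →
      Hom (B.power ([R.source, R.target].get i).vals) (B.power R.source.vals)
  | ⟨0, _⟩ => Hom.id _
  | ⟨1, _⟩ => B.powerCompHom fun c => ⟨c.1 ∘ R.pos, R.vals_pos c.1 c.2⟩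

/-- The canonical gadget. -/
def canonicalGadget (k : ℕ) {A : Structure S} (hA : A.IsFinite) {B : Structure T}
    (hB : B.IsFinite) : Gadget (canonicalSignature k hA) T where
  D P := B.power P.vals
  E R := B.power R.source.vals
  p R i := canonicalGadgetHom B R i
  finite_D _ :=
    have : Finite A.carrier := hA
    power_isFinite hB _
  finite_E _ :=
    have : Finite A.carrier := hA
    power_isFinite hB _

theorem exists_vals_of_apply {k : ℕ} {A : Structure S} (hA : A.IsFinite)
    {P : CanonicalIdb k A} (a : ((canonicalInterpretation k hA).apply A).Dom P) :
    ∃ c ∈ P.vals, List.ofFn c = a.1.2.1 := by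
  have := CanonicalIdb.finite k hA
  obtain ⟨⟨P, x, hx⟩, rfl⟩ := a
  exact canonicalProgram_holds hx

/-- The tuple of elements of `A` that an element of the canonical interpretation of `A` is. -/
noncomputable def valsOfApply {k : ℕ} {A : Structure S} (hA : A.IsFinite)
    {P : CanonicalIdb k A} (a : ((canonicalInterpretation k hA).apply A).Dom P) : P.vals :=
  ⟨_, (exists_vals_of_apply hA a).choose_spec.1⟩

theorem ofFn_valsOfApply {k : ℕ} {A : Structure S} (hA : A.IsFinite)
    {P : CanonicalIdb k A} (a : ((canonicalInterpretation k hA).apply A).Dom P) :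
    List.ofFn (valsOfApply hA a).1 = a.1.2.1 :=
  (exists_vals_of_apply hA a).choose_spec.2

/-- The concatenation output for `R` splits uniquely, since the length of its first part is fixed by
the source; comparing the parts shows that the target is the subtuple selected by `R.pos`. -/
theorem valsOfApply_comp_pos {k : ℕ} {A : Structure S} (hA : A.IsFinite) (R : CanonicalSym k A)
    (w : ((canonicalInterpretation k hA).apply A).rel R)
    (a : ((canonicalInterpretation k hA).apply A).Dom R.source)
    (b : ((canonicalInterpretation k hA).apply A).Dom R.target) (hw : w.1 = [a.1, b.1]) :
    (valsOfApply hA a).1 ∘ R.pos = (valsOfApply hA b).1 := by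
  obtain ⟨h, -, hh⟩ := mem_subtupleProgram_output.1 w.2.2
  have hab : w.1.flatMap (fun a => (a.2 : List A.carrier)) = a.1.2.1 ++ b.1.2.1 := by
    rw [hw]
    exact congrArg (a.1.2.1 ++ ·) (List.append_nil _)
  have hh := hab.symm.trans hh
  rw [← ofFn_valsOfApply hA a, ← ofFn_valsOfApply hA b] at hh
  obtain ⟨h1, h2⟩ := List.append_inj hh (by simp)
  rw [List.ofFn_injective h1]
  exact (List.ofFn_injective h2).symm

/-- An element of `φ(A)` of type `P` is a tuple lying in `P.vals`, hence a coordinate of its copy of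
`B^{P.vals}`; evaluating there respects the gluing. -/
theorem canonical_mapsTo (k : ℕ) {A : Structure S} (hA : A.IsFinite) {B : Structure T}
    (hB : B.IsFinite) :
    ((canonicalGadget k hA hB).replace ((canonicalInterpretation k hA).apply A)).MapsTo B := by
  let Y := (canonicalInterpretation k hA).apply A
  let ev : (j : Gadget.Index Y) → Hom ((canonicalGadget k hA hB).piece Y j) B
    | .inl a => B.powerEval (valsOfApply hA a.2)
    | .inr c => B.powerEval (valsOfApply hA (P := c.1.source) (Y.entry c.2 ⟨0, Nat.zero_lt_two⟩))
  refine ⟨Hom.glue _ ev ?_⟩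
  rintro _ _ ⟨R, w, ⟨i, hi⟩, e⟩
  match i, hi with
  | 0, _ => rfl
  | 1, _ =>
    refine congrArg e.2.1 (Subtype.ext ?_)
    refine valsOfApply_comp_pos hA R w _ _ ?_
    have hlen : w.1.length = 2 := Y.length_eq w.2
    refine List.ext_getElem hlen fun i h1 h2 => ?_
    match i, h2 with
    | 0, _ => rfl
    | 1, _ => rfl

/-- The enumeration of `K` is an element of `φ(X)` whose type carries exactly `ℱ_K`, so its gadget
copy is `B^{ℱ_K}` up to reindexing by the enumeration, and the subtuple symbols supply the
identifications. -/
theorem consistencyReduction_mapsTo_canonical (k : ℕ) {A : Structure S} (hA : A.IsFinite)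
    {B : Structure T} (hB : B.IsFinite) (X : Structure S) :
    (consistencyReduction k A B X).MapsTo
      ((canonicalGadget k hA hB).replace ((canonicalInterpretation k hA).apply X)) := by
  have := CanonicalIdb.finite k hA
  let Y := (canonicalInterpretation k hA).apply X
  let P (K : SmallSet X k) : CanonicalIdb k A := idbOf K (· ∈ consistentMaps k X A K)
  let x (K : SmallSet X k) : Y.carrier := ⟨P K, enum K, bounds_consistentMaps hA K⟩
  let θ (K : SmallSet X k) : (P K).vals → consistentMaps k X A K :=
    fun c => ⟨c.1 ∘ K.1.equivFin, c.2⟩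
  refine ⟨Hom.glue _ (fun K => (Hom.incl (Z := (canonicalGadget k hA hB).piece Y) _
    (.inl ⟨P K, x K, rfl⟩)).comp (B.powerCompHom (θ K))) ?_⟩
  rintro _ _ ⟨L, K, hLK, b⟩
  let R : CanonicalSym k A :=
    { source := P K
      target := P L
      pos := position hLK
      types_pos := fun j => congrArg X.ty (equivFin_symm_position hLK j)
      vals_pos := fun c hc => by
        have hc' := restrict_mem hLK (θ K ⟨c, hc⟩).2
        exact (congrArg (· ∈ consistentMaps k X A L) (comp_position hLK c)).mpr hc' }
  have hw : [x K, x L] ∈ Y.rel R := by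
    refine ⟨rfl, mem_subtupleProgram_output.2
      ⟨fun i => (K.1.equivFin.symm i).1, fun _ => rfl, ?_⟩⟩
    refine congrArg (enum K ++ ·) ((List.append_nil _).trans ?_)
    exact congrArg List.ofFn (funext fun j => (equivFin_symm_position hLK j).symm)
  -- The copies at `x K` and `x L` are linked through the copy for the pair `[x K, x L]`: coordinate
  -- `0` enters by the identity, coordinate `1` by precomposition with the selection of positions.
  refine (Quot.sound (Gadget.Glue.intro (γ := canonicalGadget k hA hB) (X := Y) R ⟨_, hw⟩
    ⟨0, Nat.zero_lt_two⟩ (B.powerComp (θ K) (B.powerComp (restrictMap k X A hLK) b)))).symm.trans ?_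
  refine Eq.trans ?_ (Quot.sound (Gadget.Glue.intro (γ := canonicalGadget k hA hB) (X := Y) R
    ⟨_, hw⟩ ⟨1, Nat.one_lt_two⟩ (B.powerComp (θ L) b)))
  refine congrArg (fun d => Quot.mk _
    (⟨.inr ⟨R, _, hw⟩, d⟩ : ((canonicalGadget k hA hB).pieces Y).carrier)) ?_
  refine power_ext rfl fun c => congrArg b.2.1 (Subtype.ext ?_)
  exact (comp_position hLK c.1).symm

end PCSP

/-! ### The equivalence -/

theorem theorem3p3 {S T : PCSP.Signature.{u}} (k : ℕ) (hk : 1 ≤ k)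
    (A A' : PCSP.Structure S) (B B' : PCSP.Structure T)
    (hA : A.IsFinite) (hAA' : A.MapsTo A') (hB : B.IsFinite) (hBB' : B.MapsTo B') :
    (∃ (U : PCSP.Signature.{u}) (φ : PCSP.DatalogInterpretation S U) (γ : PCSP.Gadget U T),
        φ.WidthAtMost k ∧
          PCSP.IsReduction A A' B B' (fun X => γ.replace (φ.apply X))) ↔
      PCSP.IsReduction A A' B B' (PCSP.consistencyReduction k A B) := by
  constructor
  · rintro ⟨U, φ, γ, hφ, hred⟩ X hX
    -- `A` is finite, hence itself an instance, and a positive one.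
    have hAB := (hred A hA).2.1 ⟨PCSP.Structure.Hom.id A⟩
    exact ⟨PCSP.consistencyReduction_isFinite k hA hB hX,
      PCSP.consistencyReduction_mapsTo k B,
      fun hXA' h => (hred X hX).2.2 hXA' ((φ.replace_apply_mapsTo γ hAB hφ X).trans h)⟩
  · intro hred
    have hφ := PCSP.canonicalInterpretation_width k hA
    refine ⟨_, PCSP.canonicalInterpretation k hA, PCSP.canonicalGadget k hA hB, hφ, fun X hX =>
      ⟨PCSP.Gadget.replace_isFinite _ (PCSP.DatalogInterpretation.apply_isFinite _ hX),
        fun hXA => ?_, fun hXA' h => ?_⟩⟩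
    -- Positive instances pass through `κ_k(X)`: the first direction's homomorphism also applies to
    -- the canonical pair.
    · exact (PCSP.DatalogInterpretation.replace_apply_mapsTo _
        (PCSP.canonical_mapsTo k hA hB) hφ X).trans ((hred X hX).2.1 hXA)
    · exact (hred X hX).2.2 hXA'
        ((PCSP.consistencyReduction_mapsTo_canonical k hA hB X).trans h)
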